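/- Let $n>0$ be an integer. For $b=(b_1,\ldots,b_n)\in\mathbf{R}^n$ let $$g_b=(x^{2n}+1)+b_1(x^{2n-1}+x)+\cdots+b_{n-1}(x^{n+1}+x^{n-1})+b_nx^n,$$ and let $V_n\subset\mathbf{R}^n$ be the set of those $b$ such that all complex roots of $g_b$ lie on the unit circle. Let $$c_1=\frac{\sqrt3}{6},\qquad c_2=\frac{2\,e^{3/2}(1+\sqrt2)\sqrt3\,\bigl(1+\sqrt3/162\bigr)^3}{3},\qquad c_3=\frac{c_2}{1+\sqrt2}.$$ Let $\Lambda\subset\mathbf{R}^n$ be a rectilinear lattice, that is, a lattice that has a fundamental domain $R$ which is a box $\prod_{i=1}^n[p_i,q_i)$ with $p_i<q_i$ (edges parallel to the coordinate axes). Let $d=\max_i(q_i-p_i)$ be its mesh, the length of the longest edge of $R$, and suppose that $d\le 1$. Then $\Lambda\cap V_n$ is finite, $V_n$ has finite volume, and $$\left|\#(\Lambda\cap V_n)-\frac{\operatorname{vol}V_n}{\operatorname{covol}\Lambda}\right|\le 6^{n^2}c_1^nc_3\,\frac{n(n+1)}{(n-1)!}\cdot\frac{d}{\operatorname{covol}\Lambda},$$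 where $\operatorname{covol}\Lambda$ is the volume of a fundamental domain of $\Lambda$. -/

import Mathlib

namespace UnitCirclePoly

open Polynomial MeasureTheory

/-- For `b = (b₁, …, bₙ)` (with `b i` standing for the entry `b_{i+1}`), the polynomial
`(x^{2n} + 1) + b₁ (x^{2n-1} + x) + ⋯ + b_{n-1} (x^{n+1} + x^{n-1}) + bₙ x^n`. -/
noncomputable def gPoly (n : ℕ) (b : Fin n → ℝ) : ℝ[X] :=
  (X ^ (2 * n) + 1) +
    ∑ i : Fin n, C (b i) *
      (if (i : ℕ) + 1 = n then X ^ n else X ^ (2 * n - (i + 1)) + X ^ ((i : ℕ) + 1))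

/-- The set `V_n` of those `b ∈ ℝⁿ` such that all complex roots of `gPoly n b` lie on the
unit circle. -/
def V (n : ℕ) : Set (Fin n → ℝ) :=
  {b | ∀ z : ℂ, aeval z (gPoly n b) = 0 → ‖z‖ = 1}

/-- The box `∏ᵢ [pᵢ, qᵢ)`, with edges parallel to the coordinate axes. -/
def box {n : ℕ} (p q : Fin n → ℝ) : Set (Fin n → ℝ) :=
  Set.univ.pi fun i => Set.Ico (p i) (q i)

/-- The (nondegenerate) box `∏ᵢ [pᵢ, qᵢ)` is a fundamental domain of `Λ`. A lattice is
rectilinear if it has such a fundamental domain. -/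
structure IsRectilinearDomain {n : ℕ} (Λ : Submodule ℤ (Fin n → ℝ)) (p q : Fin n → ℝ) :
    Prop where
  lt : ∀ i, p i < q i
  isAddFundamentalDomain : IsAddFundamentalDomain Λ (box p q) volume

/-- The length of the longest edge of the box `∏ᵢ [pᵢ, qᵢ)`. -/
noncomputable def mesh {n : ℕ} (p q : Fin n → ℝ) : ℝ := ⨆ i, (q i - p i)

noncomputable def c₁ : ℝ := √3 / 6

noncomputable def c₂ : ℝ :=
  Real.exp (3 / 2) * 2 * (1 + √2) * √3 * (1 + √3 / 162) ^ 3 / 3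

noncomputable def c₃ : ℝ := c₂ / (1 + √2)

end UnitCirclePoly

namespace UnitCirclePoly

open Polynomial MeasureTheory
open scoped Pointwise

/-! ### The trace polynomial -/

/-! Writing `g_b(z) = z ^ n * f(z + 1/z)` turns roots on the unit circle into roots of the monic
degree-`n` polynomial `f = tracePoly n b` in `[-2, 2]`, so `V n` is parametrised by `n` real roots
and is compact. Attach to each lattice point in `V n` the translate of the fundamental box with that
corner. The union of these boxes differs from `V n`, up to a null set, only within sup-distance `d`
of the frontier, so count times covolume differs from `vol V n` by at most the volume of
`nearFrontier n d` (`abs_card_mul_covolume_sub_le`). At a frontier point some root is `±2` or two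
roots coincide, since simple roots in `(-2, 2)` persist under perturbation. Hence the frontier lies
in three images of `[-2, 2]^(n-1)` (`exists_extraRoot_of_mem_frontier`) under a map that is
Lipschitz with constant `n * 4^(n-1)` (`abs_coeffMap_sub_le`). A grid on the cube covers the
neighbourhood by balls of total volume `O(d)` (`volume_nearFrontier_le`), and the resulting constant
is below the stated one (`covering_constant_le`). -/

theorem chebyshev_C_succ_monic (n : ℕ) :
    (Chebyshev.C ℝ ((n : ℤ) + 1)).Monic ∧ (Chebyshev.C ℝ ((n : ℤ) + 1)).degree =
      ((n + 1 : ℕ) : WithBot ℕ) := by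
  induction n using Nat.strong_induction_on with
  | _ n ih =>
    match n with
    | 0 => simp [monic_X]
    | 1 =>
      have h : (Chebyshev.C ℝ (((1 : ℕ) : ℤ) + 1)) = X ^ 2 - C 2 := by
        rw [show (((1 : ℕ) : ℤ) + 1) = 2 by norm_num, Chebyshev.C_two]; rfl
      rw [h]
      exact ⟨monic_X_pow_sub_C _ (by norm_num), degree_X_pow_sub_C (by norm_num) _⟩
    | n + 2 =>
      obtain ⟨h1, d1⟩ := ih (n + 1) (by omega)
      obtain ⟨h0, d0⟩ := ih n (by omega)
      have e : (Chebyshev.C ℝ (((n + 2 : ℕ) : ℤ) + 1)) =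
          X * Chebyshev.C ℝ (((n + 1 : ℕ) : ℤ) + 1) - Chebyshev.C ℝ ((n : ℤ) + 1) := by
        have := Chebyshev.C_add_two ℝ ((n : ℤ) + 1)
        push_cast
        rw [show (n : ℤ) + 2 + 1 = n + 1 + 2 by ring, this]
      have dX : (X * Chebyshev.C ℝ (((n + 1 : ℕ) : ℤ) + 1)).degree =
          ((n + 3 : ℕ) : WithBot ℕ) := by
        rw [degree_mul, d1, degree_X]; norm_cast; omega
      have hlt : (Chebyshev.C ℝ ((n : ℤ) + 1)).degree <
          (X * Chebyshev.C ℝ (((n + 1 : ℕ) : ℤ) + 1)).degree := by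
        rw [dX, d0]; norm_cast; omega
      rw [e]
      exact ⟨(monic_X.mul h1).sub_of_left hlt, by rw [degree_sub_eq_left_of_degree_lt hlt, dX]⟩

theorem chebyshev_C_eval_add_inv {K : Type*} [Field K] (z : K) (hz : z ≠ 0) (n : ℕ) :
    (Chebyshev.C K (n : ℤ)).eval (z + z⁻¹) = z ^ n + z⁻¹ ^ n := by
  induction n using Nat.strong_induction_on with
  | _ n ih =>
    match n with
    | 0 => simp; norm_num
    | 1 => simp
    | n + 2 =>
      have h1 := ih (n + 1) (by omega)
      have h0 := ih n (by omega)
      push_cast at h1 ⊢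
      rw [Chebyshev.C_add_two, eval_sub, eval_mul, h1, h0, eval_X]
      have : z * z⁻¹ = 1 := mul_inv_cancel₀ hz
      linear_combination (z ^ n + z⁻¹ ^ n) * this

/-- The real polynomial `f` of degree `n` such that `g_b(z) = z ^ n * f(z + 1/z)`. -/
noncomputable def tracePoly (n : ℕ) (b : Fin n → ℝ) : ℝ[X] :=
  Chebyshev.C ℝ n +
    ∑ i : Fin n, C (b i) * (if (i : ℕ) + 1 = n then 1 else Chebyshev.C ℝ ((n - (i + 1) : ℕ) : ℤ))

theorem tracePoly_monic_degree (m : ℕ) (b : Fin (m + 1) → ℝ) :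
    (tracePoly (m + 1) b).Monic ∧ (tracePoly (m + 1) b).degree =
      ((m + 1 : ℕ) : WithBot ℕ) := by
  obtain ⟨h, d⟩ := chebyshev_C_succ_monic m
  have hlt : (∑ i : Fin (m + 1), C (b i) * (if (i : ℕ) + 1 = m + 1 then (1 : ℝ[X]) else
      Chebyshev.C ℝ ((m + 1 - (i + 1) : ℕ) : ℤ))).degree < (Chebyshev.C ℝ ((m : ℤ) + 1)).degree := by
    rw [d]
    refine (degree_sum_le _ _).trans_lt ?_
    rw [Finset.sup_lt_iff (WithBot.bot_lt_coe _)]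
    intro i _
    rw [← smul_eq_C_mul]
    refine (degree_smul_le _ _).trans_lt ?_
    split_ifs with hi
    · rw [degree_one]; norm_cast; omega
    · obtain ⟨k, hk⟩ : ∃ k, m + 1 - ((i : ℕ) + 1) = k + 1 :=
        ⟨m + 1 - ((i : ℕ) + 1) - 1, by omega⟩
      rw [hk]
      have := (chebyshev_C_succ_monic k).2
      push_cast at this ⊢
      rw [this]; norm_cast; omega
  unfold tracePoly
  push_cast
  push_cast at hlt
  exact ⟨h.add_of_left hlt, by rw [degree_add_eq_left_of_degree_lt hlt, d]; norm_cast⟩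

theorem tracePoly_natDegree (m : ℕ) (b : Fin (m + 1) → ℝ) :
    (tracePoly (m + 1) b).natDegree = m + 1 :=
  natDegree_eq_of_degree_eq_some (tracePoly_monic_degree m b).2

/-- The palindromic pairs are `z ^ n * (z ^ k + z⁻¹ ^ k)`, and the bracket is the Chebyshev value at
`z + z⁻¹`. The middle term is separate because `Chebyshev.C` at index 0 is 2, which would count `z ^
n` twice. -/
theorem aeval_gPoly_eq {K : Type*} [Field K] [Algebra ℝ K] (n : ℕ) (b : Fin n → ℝ) (z : K)
    (hz : z ≠ 0) : aeval z (gPoly n b) = z ^ n * aeval (z + z⁻¹) (tracePoly n b) := by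
  have key : ∀ k, k ≤ n → z ^ n * (z ^ k + z⁻¹ ^ k) = z ^ (n + k) + z ^ (n - k) := by
    intro k hk
    rw [mul_add, ← pow_add, inv_pow, pow_sub₀ z hz hk]
  unfold gPoly tracePoly
  simp only [map_add, map_sum, map_mul, map_pow, aeval_X, aeval_C, map_one, Chebyshev.aeval_C,
    chebyshev_C_eval_add_inv z hz, mul_add, Finset.mul_sum]
  congr 1
  · rw [← mul_add, key n le_rfl]; simp [two_mul]
  · refine Finset.sum_congr rfl fun i _ => ?_
    split_ifs with h
    · simp; ring
    · have := key (n - (i + 1)) (by omega)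
      simp only [map_add, map_pow, aeval_X, Chebyshev.aeval_C, chebyshev_C_eval_add_inv z hz]
      rw [mul_left_comm, this]
      congr 3 <;> omega

theorem gPoly_coeff_zero (n : ℕ) (hn : 0 < n) (b : Fin n → ℝ) : (gPoly n b).coeff 0 = 1 := by
  unfold gPoly
  simp only [coeff_add, finsetSum_coeff, coeff_C_mul]
  rw [Finset.sum_eq_zero]
  · simp [coeff_X_pow]; omega
  · intro i _
    split_ifs with h
    · simp [coeff_X_pow]; omega
    · simp [coeff_X_pow]; omega

theorem gPoly_coeff_succ (n : ℕ) (b : Fin n → ℝ) (i : Fin n) :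
    (gPoly n b).coeff (i + 1) = b i := by
  unfold gPoly
  simp only [coeff_add, finsetSum_coeff, coeff_C_mul]
  rw [Finset.sum_eq_single i]
  · have hi := i.2
    split_ifs with h
    · simp only [coeff_X_pow, coeff_one]
      rw [if_neg (by omega), if_neg (by omega), if_pos (by omega)]; simp
    · have h1 : (i : ℕ) + 1 ≠ 2 * n := by omega
      have h2 : (i : ℕ) + 1 ≠ 2 * n - (i + 1) := by omega
      simp [coeff_X_pow, coeff_one, h1, h2]
  · intro j _ hj
    have hi := i.2
    have hj2 := j.2
    have hj' : (j : ℕ) ≠ i := fun h => hj (Fin.ext h)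
    split_ifs with h
    · rw [coeff_X_pow, if_neg (by omega), mul_zero]
    · rw [coeff_add, coeff_X_pow, coeff_X_pow, if_neg (by omega), if_neg (by omega)]; simp
  · simp

/-! ### Roots on the circle and roots of the trace polynomial -/

/-- The imaginary part of `z² + 1 = a z` forces `z` to be real or `re z = a / 2`. In the real case
the discriminant `a² - 4 ≤ 0` leaves only `z = ±1`. -/
theorem norm_eq_one_of_add_inv_eq {z : ℂ} (hz : z ≠ 0) {a : ℝ} (ha : |a| ≤ 2)
    (h : z + z⁻¹ = a) : ‖z‖ = 1 := by
  have h2 : z * z + 1 = a * z := by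
    rw [← h, add_mul, inv_mul_cancel₀ hz]
  have hre := congrArg Complex.re h2
  have him := congrArg Complex.im h2
  simp at hre him
  have ha2 : a ^ 2 ≤ 4 := by
    have := sq_le_sq' (abs_le.1 ha).1 (abs_le.1 ha).2; linarith
  have : z.re ^ 2 + z.im ^ 2 = 1 := by
    have hf : z.im * (2 * z.re - a) = 0 := by linarith
    rcases mul_eq_zero.1 hf with h0 | h0
    · rw [h0] at hre ⊢
      have hs : (z.re - a / 2) ^ 2 = a ^ 2 / 4 - 1 := by linear_combination hre
      have : z.re - a / 2 = 0 := by
        apply pow_eq_zero_iff (n := 2) (by norm_num) |>.1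
        apply le_antisymm _ (sq_nonneg _)
        linarith
      have e : z.re = a / 2 := by linarith
      rw [e] at hre ⊢
      linarith
    · have e : a = 2 * z.re := by linarith
      rw [e] at hre
      linarith
  rw [Complex.norm_eq_sqrt_sq_add_sq, this, Real.sqrt_one]

theorem mem_V_of_tracePoly_roots {n : ℕ} (hn : 0 < n) {b : Fin n → ℝ}
    (h : ∀ w : ℂ, aeval w (tracePoly n b) = 0 → ∃ a : ℝ, |a| ≤ 2 ∧ w = a) : b ∈ V n := by
  intro z hz
  have hz0 : z ≠ 0 := by
    rintro rfl
    rw [← coeff_zero_eq_aeval_zero', gPoly_coeff_zero n hn] at hz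
    simp at hz
  rw [aeval_gPoly_eq n b z hz0] at hz
  obtain ⟨a, ha, e⟩ := h _ ((mul_eq_zero.1 hz).resolve_left (pow_ne_zero _ hz0))
  exact norm_eq_one_of_add_inv_eq hz0 ha e

theorem exists_add_inv_eq (w : ℂ) : ∃ z : ℂ, z ≠ 0 ∧ z + z⁻¹ = w := by
  obtain ⟨s, hs⟩ := IsAlgClosed.exists_pow_nat_eq (w ^ 2 - 4) (n := 2) (by norm_num)
  have h : (w + s) / 2 * ((w - s) / 2) = 1 := by linear_combination -hs / 4
  refine ⟨(w + s) / 2, left_ne_zero_of_mul_eq_one h, ?_⟩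
  rw [inv_eq_of_mul_eq_one_right h]
  ring

theorem tracePoly_root_of_mem_V {n : ℕ} {b : Fin n → ℝ} (hb : b ∈ V n) {w : ℂ}
    (hw : aeval w (tracePoly n b) = 0) : ∃ a : ℝ, |a| ≤ 2 ∧ w = a := by
  obtain ⟨z, hz, rfl⟩ := exists_add_inv_eq w
  have h1 : ‖z‖ = 1 := hb z (by rw [aeval_gPoly_eq n b z hz, hw, mul_zero])
  refine ⟨2 * z.re, ?_, ?_⟩
  · rw [abs_mul]
    have := Complex.abs_re_le_norm z
    norm_num
    linarith
  · rw [Complex.inv_eq_conj h1, Complex.add_conj]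

theorem exists_tracePoly_eq_prod {m : ℕ} {b : Fin (m + 1) → ℝ} (hb : b ∈ V (m + 1)) :
    ∃ y : Fin (m + 1) → ℝ, (∀ k, |y k| ≤ 2) ∧ tracePoly (m + 1) b = ∏ k, (X - C (y k)) := by
  have hm := (tracePoly_monic_degree m b).1
  have hs : (tracePoly (m + 1) b).Splits := by
    refine Splits.of_splits_map (algebraMap ℝ ℂ) (IsAlgClosed.splits _) fun w hw => ?_
    rw [mem_roots (hm.map _).ne_zero, IsRoot, eval_map_algebraMap] at hw
    obtain ⟨a, -, rfl⟩ := tracePoly_root_of_mem_V hb hw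
    exact ⟨a, rfl⟩
  have hcard : (tracePoly (m + 1) b).roots.card = m + 1 := by
    rw [← hs.natDegree_eq_card_roots, tracePoly_natDegree]
  have hprod := hs.eq_prod_roots_of_monic hm
  -- An ordering of the root multiset provides the indexing by `Fin (m + 1)`.
  obtain ⟨l, hl⟩ := Quot.exists_rep (tracePoly (m + 1) b).roots
  have hl' : (tracePoly (m + 1) b).roots = (l : Multiset ℝ) := hl.symm
  rw [hl'] at hcard hprod
  have hlen : l.length = m + 1 := by simpa using hcard
  refine ⟨fun k => l.get (k.cast hlen.symm), fun k => ?_, ?_⟩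
  · have hk : l.get (k.cast hlen.symm) ∈ (tracePoly (m + 1) b).roots := by
      rw [hl']; exact List.get_mem _ _
    rw [mem_roots hm.ne_zero, IsRoot] at hk
    obtain ⟨a, ha, e⟩ := tracePoly_root_of_mem_V (w := (l.get (k.cast hlen.symm) : ℝ)) hb (by
      rw [show ((l.get (k.cast hlen.symm) : ℝ) : ℂ) = algebraMap ℝ ℂ _ from rfl,
        aeval_algebraMap_apply, coe_aeval_eq_eval, hk, map_zero])
    change |l.get (k.cast hlen.symm)| ≤ 2
    rw [Complex.ofReal_inj.1 e]; exact ha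
  · rw [hprod]
    rw [Multiset.map_coe, Multiset.prod_coe]
    have := List.prod_ofFn (f := fun k => (X - C (l.get k) : ℝ[X]))
    rw [← Fin.prod_congr' (fun k => (X - C (l.get k) : ℝ[X])) hlen.symm] at this
    rw [← this]
    congr 1
    conv_lhs => rw [← List.ofFn_get l, List.map_ofFn]
    rfl

theorem gPoly_eq_prod {n : ℕ} {b : Fin n → ℝ} {y : Fin n → ℝ}
    (h : tracePoly n b = ∏ k, (X - C (y k))) : gPoly n b = ∏ k, (X ^ 2 - C (y k) * X + 1) := by
  refine eq_of_infinite_eval_eq _ _ (Set.Infinite.mono (s := {x : ℝ | x ≠ 0}) ?_ ?_)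
  · intro x hx
    have := aeval_gPoly_eq n b x hx
    simp only [coe_aeval_eq_eval] at this
    simp only [Set.mem_ofPred_eq]
    rw [this, h, eval_prod, eval_prod, ← Fin.prod_const, ← Finset.prod_mul_distrib]
    refine Finset.prod_congr rfl fun k _ => ?_
    have hx' : x * x⁻¹ = 1 := mul_inv_cancel₀ hx
    simp
    linear_combination hx'
  · exact (Set.finite_singleton (0 : ℝ)).infinite_compl

/-! ### Compactness of `V n` -/

/-- The parameters `b` read off from the product `∏ₖ (x² - yₖ x + 1)`. -/
noncomputable def coeffMap (n : ℕ) (y : Fin n → ℝ) (i : Fin n) : ℝ :=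
  (∏ k, (X ^ 2 - C (y k) * X + 1 : ℝ[X])).coeff (i + 1)

theorem eq_coeffMap {n : ℕ} {b y : Fin n → ℝ} (h : tracePoly n b = ∏ k, (X - C (y k))) :
    b = coeffMap n y := by
  funext i
  rw [coeffMap, ← gPoly_eq_prod h, gPoly_coeff_succ]

theorem continuous_prod_coeff {n : ℕ} (s : Finset (Fin n)) (j : ℕ) :
    Continuous fun y : Fin n → ℝ => (∏ k ∈ s, (X ^ 2 - C (y k) * X + 1 : ℝ[X])).coeff j := by
  classical
  induction s using Finset.induction_on generalizing j with
  | empty => simpa using continuous_const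
  | insert a s ha ih =>
    simp only [Finset.prod_insert ha, coeff_mul]
    refine continuous_finsetSum _ fun p _ => Continuous.mul ?_ (ih _)
    simp only [coeff_add, coeff_sub, coeff_C_mul]
    fun_prop

theorem continuous_coeffMap (n : ℕ) : Continuous (coeffMap n) :=
  continuous_pi fun i => continuous_prod_coeff Finset.univ (i + 1)

theorem continuous_eval_gPoly (n : ℕ) (x : ℝ) :
    Continuous fun b : Fin n → ℝ => (gPoly n b).eval x := by
  simp only [gPoly, eval_add, eval_finsetSum, eval_mul, eval_C]
  fun_prop

theorem continuous_eval_tracePoly (n : ℕ) (x : ℝ) :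
    Continuous fun b : Fin n → ℝ => (tracePoly n b).eval x := by
  simp only [tracePoly, eval_add, eval_finsetSum, eval_mul, eval_C]
  fun_prop

theorem mem_V_of_gPoly_eq_prod {n : ℕ} {b y : Fin n → ℝ} (hy : ∀ k, |y k| ≤ 2)
    (h : gPoly n b = ∏ k, (X ^ 2 - C (y k) * X + 1)) : b ∈ V n := by
  intro z hz
  rw [h, map_prod, Finset.prod_eq_zero_iff] at hz
  obtain ⟨k, -, hk⟩ := hz
  simp only [map_add, map_sub, map_pow, aeval_X, map_mul, aeval_C, map_one,
    Complex.coe_algebraMap] at hk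
  have hz0 : z ≠ 0 := by rintro rfl; simp at hk
  refine norm_eq_one_of_add_inv_eq hz0 (hy k) ?_
  field_simp
  linear_combination hk

/-- `V` is a continuous image of a closed subset of a cube. The evaluation identities cutting out
that subset always hold, the product being palindromic; imposing them as closed conditions makes a
proof of this unnecessary. -/
theorem isCompact_V (m : ℕ) : IsCompact (V (m + 1)) := by
  have hV : V (m + 1) = coeffMap (m + 1) '' ((Set.univ.pi fun _ => Set.Icc (-2) 2) ∩
      {y | ∀ x : ℝ, (gPoly (m + 1) (coeffMap (m + 1) y)).eval x =
        ∏ k, (x ^ 2 - y k * x + 1)}) := by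
    ext b
    constructor
    · intro hb
      obtain ⟨y, hy, h⟩ := exists_tracePoly_eq_prod hb
      refine ⟨y, ⟨fun k _ => abs_le.1 (hy k), fun x => ?_⟩, (eq_coeffMap h).symm⟩
      rw [← eq_coeffMap h, gPoly_eq_prod h, eval_prod]
      simp
    · rintro ⟨y, ⟨hy, h⟩, rfl⟩
      refine mem_V_of_gPoly_eq_prod (fun k => abs_le.2 (hy k trivial)) ?_
      refine Polynomial.funext fun x => ?_
      rw [h x, eval_prod]
      simp
  rw [hV]
  refine IsCompact.image ?_ (continuous_coeffMap _)
  refine (isCompact_univ_pi fun _ => isCompact_Icc).inter_right ?_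
  rw [Set.ofPred_forall]
  refine isClosed_iInter fun x => isClosed_eq ?_ (by fun_prop)
  exact (continuous_eval_gPoly _ x).comp (continuous_coeffMap _)

/-! ### The frontier of `V n` -/

theorem exists_eps {m : ℕ} {y : Fin (m + 1) → ℝ} (hy : ∀ k, |y k| < 2)
    (hinj : Function.Injective y) :
    ∃ ε > 0, (∀ k, |y k| + ε ≤ 2) ∧ ∀ k l, k ≠ l → 2 * ε < |y k - y l| := by
  have h1 : ∀ k, ∀ᶠ ε in nhdsWithin (0 : ℝ) (Set.Ioi 0), |y k| + ε ≤ 2 := by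
    intro k
    have : Filter.Tendsto (fun ε : ℝ => |y k| + ε) (nhdsWithin 0 (Set.Ioi 0)) (nhds (|y k| + 0)) :=
      (Continuous.tendsto (by fun_prop) 0).mono_left nhdsWithin_le_nhds
    exact this.eventually_le_const (by simpa using hy k)
  have h2 : ∀ k l, ∀ᶠ ε in nhdsWithin (0 : ℝ) (Set.Ioi 0), k ≠ l → 2 * ε < |y k - y l| := by
    intro k l
    by_cases hkl : k = l
    · simp [hkl]
    have : Filter.Tendsto (fun ε : ℝ => 2 * ε) (nhdsWithin 0 (Set.Ioi 0)) (nhds (2 * 0)) :=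
      (Continuous.tendsto (by fun_prop) 0).mono_left nhdsWithin_le_nhds
    have hp : (2 : ℝ) * 0 < |y k - y l| := by
      rw [mul_zero]; exact abs_pos.2 (sub_ne_zero.2 fun h => hkl (hinj h))
    filter_upwards [this.eventually_lt_const hp] with ε hε _ using hε
  have h3 := (Filter.eventually_all.2 h1).and
    ((Filter.eventually_all.2 fun k => Filter.eventually_all.2 (h2 k)).and self_mem_nhdsWithin)
  obtain ⟨ε, ha, hb, hc⟩ := h3.exists
  exact ⟨ε, hc, ha, hb⟩

/-- The factor `l = k` contributes `-ε²`, every other one `(y k - y l)² - ε² > 0`. -/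
theorem prod_eval_mul_neg {n : ℕ} {y : Fin n → ℝ} {ε : ℝ} (hε : 0 < ε)
    (h : ∀ k l, k ≠ l → 2 * ε < |y k - y l|) (k : Fin n) :
    (∏ l, (X - C (y l))).eval (y k - ε) * (∏ l, (X - C (y l))).eval (y k + ε) < 0 := by
  classical
  rw [eval_prod, eval_prod, ← Finset.prod_mul_distrib,
    ← Finset.mul_prod_erase _ _ (Finset.mem_univ k)]
  refine mul_neg_of_neg_of_pos ?_ (Finset.prod_pos fun l hl => ?_)
  · simpa using hε.ne'
  · have := h k l (Finset.ne_of_mem_erase hl).symm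
    have h2 : (2 * ε) ^ 2 < (y k - y l) ^ 2 := sq_lt_sq.2 (by rwa [abs_of_pos (by linarith)])
    simp only [eval_sub, eval_X, eval_C]
    nlinarith [sq_nonneg ε]

theorem exists_root_Ioo {p : ℝ[X]} {u v : ℝ} (huv : u ≤ v) (h : p.eval u * p.eval v < 0) :
    ∃ x ∈ Set.Ioo u v, p.eval x = 0 := by
  rcases mul_neg_iff.1 h with ⟨h1, h2⟩ | ⟨h1, h2⟩
  · exact intermediate_value_Ioo' huv p.continuousOn ⟨h2, h1⟩
  · exact intermediate_value_Ioo huv p.continuousOn ⟨h1, h2⟩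

theorem mem_V_of_real_roots {m : ℕ} {b x : Fin (m + 1) → ℝ} (hx : ∀ k, |x k| ≤ 2)
    (hinj : Function.Injective x) (h : ∀ k, (tracePoly (m + 1) b).eval (x k) = 0) :
    b ∈ V (m + 1) := by
  classical
  have hm := (tracePoly_monic_degree m b).1
  refine mem_V_of_tracePoly_roots m.succ_pos fun w hw => ?_
  by_contra! hne
  have hp : (tracePoly (m + 1) b).map (algebraMap ℝ ℂ) ≠ 0 := (hm.map _).ne_zero
  have hsub : insert w (Finset.univ.image fun k => (x k : ℂ)) ⊆
      ((tracePoly (m + 1) b).map (algebraMap ℝ ℂ)).roots.toFinset := by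
    intro z hz
    rw [Multiset.mem_toFinset, mem_roots hp, IsRoot, eval_map_algebraMap]
    rcases Finset.mem_insert.1 hz with rfl | hz
    · exact hw
    · obtain ⟨k, -, rfl⟩ := Finset.mem_image.1 hz
      rw [← Complex.coe_algebraMap, aeval_algebraMap_apply, coe_aeval_eq_eval, h, map_zero]
  have hcard := (Finset.card_le_card hsub).trans
    ((Multiset.toFinset_card_le _).trans (card_roots' _))
  rw [natDegree_map, tracePoly_natDegree, Finset.card_insert_of_notMem, Finset.card_image_of_injective,
    Finset.card_univ, Fintype.card_fin] at hcard
  · omega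
  · exact Complex.ofReal_injective.comp hinj
  · intro hw'
    obtain ⟨k, -, hk⟩ := Finset.mem_image.1 hw'
    exact hne (x k) (hx k) hk.symm

/-- Sign changes around the simple roots are an open condition on `b`. They give nearby parameters
`m + 1` distinct roots in `[-2, 2]`, which exhaust the degree. -/
theorem mem_interior_V {m : ℕ} {b y : Fin (m + 1) → ℝ} (hy : ∀ k, |y k| < 2)
    (hinj : Function.Injective y) (h : tracePoly (m + 1) b = ∏ k, (X - C (y k))) :
    b ∈ interior (V (m + 1)) := by
  obtain ⟨ε, hε, hle, hsep⟩ := exists_eps hy hinj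
  have hev : ∀ᶠ b' in nhds b, ∀ k, (tracePoly (m + 1) b').eval (y k - ε) *
      (tracePoly (m + 1) b').eval (y k + ε) < 0 := by
    refine Filter.eventually_all.2 fun k => ?_
    refine ((continuous_eval_tracePoly _ _).mul
      (continuous_eval_tracePoly _ _)).continuousAt.eventually_lt_const ?_
    change (tracePoly (m + 1) b).eval (y k - ε) * (tracePoly (m + 1) b).eval (y k + ε) < 0
    rw [h]
    exact prod_eval_mul_neg hε hsep k
  rw [mem_interior_iff_mem_nhds]
  filter_upwards [hev] with b' hb'
  choose x hx hroot using fun k => exists_root_Ioo (by linarith) (hb' k)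
  have hxy : ∀ k, |x k - y k| < ε := fun k => by
    rw [abs_lt]; constructor <;> linarith [(hx k).1, (hx k).2]
  refine mem_V_of_real_roots (x := x) (fun k => ?_) (fun k l hkl => ?_) hroot
  · have := abs_add_le (x k - y k) (y k)
    rw [sub_add_cancel] at this
    linarith [hxy k, hle k]
  · by_contra hne
    have h1 := hsep k l hne
    have h2 := abs_sub_le (y k) (x k) (y l)
    have h3 := hxy k
    have h4 := hxy l
    rw [← hkl] at h4
    rw [abs_sub_comm] at h3
    linarith

/-- The three ways to complete `n - 1` roots to a degenerate system of `n` roots: with the root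
`2`, with the root `-2`, or by doubling the first root. -/
noncomputable def extraRoot {m : ℕ} (j : Fin 3) (w : Fin m → ℝ) : ℝ :=
  match j with
  | 0 => 2
  | 1 => -2
  | 2 => if h : 0 < m then w ⟨0, h⟩ else 0

theorem abs_extraRoot_le {m : ℕ} (j : Fin 3) {w : Fin m → ℝ} (hw : ∀ k, |w k| ≤ 2) :
    |extraRoot j w| ≤ 2 := by
  fin_cases j
  · simp [extraRoot]
  · simp [extraRoot]
  · simp only [extraRoot]
    split_ifs
    · exact hw _
    · simp

theorem abs_extraRoot_sub_le {m : ℕ} (j : Fin 3) {w w' : Fin m → ℝ} {δ : ℝ} (hδ : 0 ≤ δ)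
    (hw : ∀ k, |w k - w' k| ≤ δ) : |extraRoot j w - extraRoot j w'| ≤ δ := by
  fin_cases j
  · simpa [extraRoot] using hδ
  · simpa [extraRoot] using hδ
  · simp only [extraRoot]
    split_ifs
    · exact hw _
    · simpa using hδ

theorem exists_extraRoot_of_mem_frontier {m : ℕ} {b : Fin (m + 1) → ℝ}
    (hb : b ∈ frontier (V (m + 1))) :
    ∃ (j : Fin 3) (w : Fin m → ℝ), (∀ k, |w k| ≤ 2) ∧
      b = coeffMap (m + 1) (Fin.cons (extraRoot j w) w) := by
  have hbV : b ∈ V (m + 1) := (isCompact_V m).isClosed.frontier_subset hb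
  obtain ⟨y, hy, h⟩ := exists_tracePoly_eq_prod hbV
  have hperm : ∀ σ : Equiv.Perm (Fin (m + 1)),
      tracePoly (m + 1) b = ∏ k, (X - C ((y ∘ σ) k)) := fun σ => by
    rw [h]; exact (Equiv.prod_comp σ fun k => (X - C (y k) : ℝ[X])).symm
  have hend : ∀ j : Fin 3, ∀ i, (∀ w : Fin m → ℝ, extraRoot j w = y i) →
      ∃ (j : Fin 3) (w : Fin m → ℝ), (∀ k, |w k| ≤ 2) ∧
        b = coeffMap (m + 1) (Fin.cons (extraRoot j w) w) := by
    intro j i hj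
    refine ⟨j, Fin.tail (y ∘ Equiv.swap 0 i), fun k => hy _, ?_⟩
    rw [hj, show y i = (y ∘ Equiv.swap 0 i) 0 by simp, Fin.cons_self_tail]
    exact eq_coeffMap (hperm _)
  by_cases hopen : ∀ k, |y k| < 2
  · have hinj : ¬ Function.Injective y := fun hinj =>
      hb.2 (mem_interior_V hopen hinj h)
    simp only [Function.Injective, not_forall] at hinj
    obtain ⟨i, l, hil, hne⟩ := hinj
    -- One copy of the double root moves to position 0 and its twin to the head of the tail, where
    -- `extraRoot 2` reads it.
    set y' := y ∘ Equiv.swap 0 i with hy'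
    obtain ⟨k, hk⟩ : ∃ k : Fin m, k.succ = Equiv.swap 0 i l := by
      apply Fin.exists_succ_eq.2
      intro h0
      apply hne
      have := congrArg (Equiv.swap 0 i) h0
      simpa using this.symm
    -- Hence the default value 0 in `extraRoot` does not occur here.
    have hm : 0 < m := k.pos
    let σ : Equiv.Perm (Fin m) := Equiv.swap ⟨0, hm⟩ k
    have hw0 : extraRoot 2 (Fin.tail y' ∘ σ) = y' 0 := by
      simp only [extraRoot, hm, dif_pos, σ]
      simp [Fin.tail, hk, hy', hil]
    refine ⟨2, Fin.tail y' ∘ σ, fun k => hy _, ?_⟩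
    rw [hw0]
    refine eq_coeffMap ?_
    rw [hperm (Equiv.swap 0 i), ← hy', Fin.prod_univ_succ, Fin.prod_univ_succ]
    simp only [Fin.cons_zero, Fin.cons_succ]
    congr 1
    exact (Equiv.prod_comp σ fun k => (X - C (y' k.succ) : ℝ[X])).symm
  · push Not at hopen
    obtain ⟨i, hi⟩ := hopen
    have h2 : |y i| = 2 := le_antisymm (hy i) hi
    rcases (abs_eq (by norm_num)).1 h2 with h2 | h2
    · exact hend 0 i fun w => by rw [h2]; rfl
    · exact hend 1 i fun w => by rw [h2]; rfl

/-! ### A Lipschitz bound for the coefficients -/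

/-- Coefficientwise domination of `p` by `P`. -/
def Dominated (p P : ℝ[X]) : Prop := ∀ j, |p.coeff j| ≤ P.coeff j

theorem Dominated.mul {p q P Q : ℝ[X]} (hp : Dominated p P) (hq : Dominated q Q) :
    Dominated (p * q) (P * Q) := by
  intro j
  rw [coeff_mul, coeff_mul]
  refine (Finset.abs_sum_le_sum_abs _ _).trans (Finset.sum_le_sum fun x _ => ?_)
  rw [abs_mul]
  exact mul_le_mul (hp _) (hq _) (abs_nonneg _) ((abs_nonneg _).trans (hp _))

theorem Dominated.add {p q P Q : ℝ[X]} (hp : Dominated p P) (hq : Dominated q Q) :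
    Dominated (p + q) (P + Q) := by
  intro j
  rw [coeff_add, coeff_add]
  exact (abs_add_le _ _).trans (add_le_add (hp j) (hq j))

theorem one_add_X_sq_eq : ((1 + X) ^ 2 : ℝ[X]) = X ^ 2 + C 2 * X + 1 := by
  rw [show (C 2 : ℝ[X]) = 2 from rfl]; ring

theorem dominated_quadratic {a : ℝ} (ha : |a| ≤ 2) :
    Dominated (X ^ 2 - C a * X + 1) ((1 + X) ^ 2) := by
  intro j
  rw [one_add_X_sq_eq]
  simp only [coeff_add, coeff_sub, coeff_C_mul, coeff_X_pow, coeff_X, coeff_one]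
  match j with
  | 0 => simp
  | 1 => simpa using ha
  | 2 => simp
  | j + 3 => simp

/-- The difference is a multiple of `X`, whose coefficient in `(1 + X) ^ 2` is 2. Bounding by the
whole square lets products be dominated by powers of `1 + X`. -/
theorem dominated_quadratic_sub {a a' δ : ℝ} (h : |a - a'| ≤ δ) :
    Dominated ((X ^ 2 - C a * X + 1) - (X ^ 2 - C a' * X + 1)) (C (δ / 2) * (1 + X) ^ 2) := by
  intro j
  have hδ : 0 ≤ δ := (abs_nonneg _).trans h
  rw [one_add_X_sq_eq]
  simp only [coeff_add, coeff_sub, coeff_C_mul, coeff_X_pow, coeff_X, coeff_one]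
  match j with
  | 0 => simp; linarith
  | 1 => simp; rw [abs_sub_comm, neg_add_eq_sub, abs_sub_comm] at *; linarith
  | 2 => simp; linarith
  | j + 3 => simp

theorem dominated_prod {ι : Type*} (s : Finset ι) {y : ι → ℝ} (hy : ∀ k, |y k| ≤ 2) :
    Dominated (∏ k ∈ s, (X ^ 2 - C (y k) * X + 1)) (((1 + X) ^ 2) ^ s.card) := by
  classical
  induction s using Finset.induction_on with
  | empty =>
    intro j
    simp only [Finset.prod_empty, Finset.card_empty, pow_zero, coeff_one]
    split_ifs <;> simp
  | insert a s ha ih =>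
    rw [Finset.prod_insert ha, Finset.card_insert_of_notMem ha,
      pow_succ' ((1 + X) ^ 2 : ℝ[X])]
    exact (dominated_quadratic (hy a)).mul ih

theorem dominated_prod_sub {ι : Type*} (s : Finset ι) {y y' : ι → ℝ} {δ : ℝ}
    (hy : ∀ k, |y k| ≤ 2) (hy' : ∀ k, |y' k| ≤ 2) (h : ∀ k, |y k - y' k| ≤ δ) :
    Dominated (∏ k ∈ s, (X ^ 2 - C (y k) * X + 1) - ∏ k ∈ s, (X ^ 2 - C (y' k) * X + 1))
      (C (s.card * (δ / 2)) * ((1 + X) ^ 2) ^ s.card) := by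
  classical
  induction s using Finset.induction_on with
  | empty => intro j; simp
  | insert a s ha ih =>
    rw [Finset.prod_insert ha, Finset.prod_insert ha, Finset.card_insert_of_notMem ha]
    have h1 := (dominated_quadratic_sub (h a)).mul (dominated_prod s hy)
    have h2 := (dominated_quadratic (hy' a)).mul ih
    -- Telescoping: `p P - p' P' = (p - p') P + p' (P - P')`.
    convert h1.add h2 using 1
    · ring
    · push_cast
      simp only [C_mul, C_add, C_1]
      ring

/-- The central coefficient is twice `(2m+1).choose m`, a term of a half-row sum equal to `4 ^ m`.
-/
theorem centralBinom_two_mul_le (m : ℕ) : 2 * (m + 1).centralBinom ≤ 4 ^ (m + 1) := by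
  have h := Nat.sum_range_choose_halfway m
  have h2 : (2 * m + 1).choose m ≤ ∑ i ∈ Finset.range (m + 1), (2 * m + 1).choose i :=
    Finset.single_le_sum (f := fun i => (2 * m + 1).choose i) (fun _ _ => Nat.zero_le _)
      (Finset.self_mem_range_succ m)
  have h3 : (m + 1).centralBinom = 2 * (2 * m + 1).choose m := by
    rw [Nat.centralBinom, show 2 * (m + 1) = 2 * m + 1 + 1 by ring, Nat.choose_succ_succ,
      Nat.choose_symm_half]
    ring
  rw [h3, pow_succ]
  linarith

theorem abs_coeffMap_sub_le {m : ℕ} {y y' : Fin (m + 1) → ℝ} {δ : ℝ}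
    (hy : ∀ k, |y k| ≤ 2) (hy' : ∀ k, |y' k| ≤ 2) (h : ∀ k, |y k - y' k| ≤ δ)
    (i : Fin (m + 1)) :
    |coeffMap (m + 1) y i - coeffMap (m + 1) y' i| ≤ (m + 1) * δ * 4 ^ m := by
  have hδ : 0 ≤ δ := (abs_nonneg _).trans (h 0)
  have := dominated_prod_sub Finset.univ hy hy' h (i + 1)
  rw [coeff_sub, coeff_C_mul, ← pow_mul, coeff_one_add_X_pow, Finset.card_univ,
    Fintype.card_fin] at this
  refine this.trans ?_
  have h1 : (((2 * (m + 1)).choose (i + 1) : ℕ) : ℝ) * 2 ≤ 4 ^ (m + 1) := by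
    have h2 : (2 * (m + 1)).choose (i + 1) ≤ (m + 1).centralBinom :=
      Nat.choose_le_centralBinom _ _
    have h3 := centralBinom_two_mul_le m
    exact_mod_cast (by omega : (2 * (m + 1)).choose (i + 1) * 2 ≤ 4 ^ (m + 1))
  push_cast
  calc ((m : ℝ) + 1) * (δ / 2) * ((2 * (m + 1)).choose (i + 1) : ℕ)
      = ((m : ℝ) + 1) * δ / 4 * (((2 * (m + 1)).choose (i + 1) : ℕ) * 2) := by ring
    _ ≤ ((m : ℝ) + 1) * δ / 4 * 4 ^ (m + 1) := by gcongr
    _ = (m + 1) * δ * 4 ^ m := by ring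

/-! ### The neighbourhood of the frontier -/

/-- The grid points are the midpoints of `M` equal subintervals of `[-2, 2]`. -/
theorem exists_grid_point {M : ℕ} (hM : 0 < M) {x : ℝ} (hx : |x| ≤ 2) :
    ∃ k : Fin M, |(-2 + (4 * (k : ℝ) + 2) / M : ℝ)| ≤ 2 ∧
      |x - (-2 + (4 * (k : ℝ) + 2) / M)| ≤ 2 / M := by
  obtain ⟨hx1, hx2⟩ := abs_le.1 hx
  have hM' : (0 : ℝ) < M := by exact_mod_cast hM
  have hbound : ∀ k : Fin M, |(-2 + (4 * (k : ℝ) + 2) / M : ℝ)| ≤ 2 := by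
    intro k
    have hk : (k : ℝ) + 1 ≤ M := by exact_mod_cast k.2
    have h1 : (4 * (k : ℝ) + 2) / M ≤ 4 := by rw [div_le_iff₀ hM']; linarith
    have h2 : 0 ≤ (4 * (k : ℝ) + 2) / M := by positivity
    rw [abs_le]; constructor <;> linarith
  have key : ∀ k : Fin M, (k : ℝ) ≤ (x + 2) * M / 4 → (x + 2) * M / 4 ≤ k + 1 →
      |x - (-2 + (4 * (k : ℝ) + 2) / M)| ≤ 2 / M := by
    intro k h1 h2
    have e : x - (-2 + (4 * (k : ℝ) + 2) / M) = ((x + 2) * M - (4 * k + 2)) / M := by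
      field_simp; ring
    rw [e, abs_div, abs_of_pos hM']
    gcongr
    rw [abs_le]; constructor <;> linarith
  rcases hx2.lt_or_eq with hlt | rfl
  · have hnn : 0 ≤ (x + 2) * M / 4 := by
      have : 0 ≤ x + 2 := by linarith
      positivity
    have hl : ⌊(x + 2) * M / 4⌋₊ < M := by
      rw [Nat.floor_lt hnn]
      nlinarith
    exact ⟨⟨_, hl⟩, hbound _, key _ (Nat.floor_le hnn) (Nat.lt_floor_add_one _).le⟩
  -- At `x = 2` the floor would be `M`, so the last subinterval is used.
  · refine ⟨⟨M - 1, by omega⟩, hbound _, key _ ?_ ?_⟩ <;>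
    · simp only [Nat.cast_sub (Nat.succ_le_of_lt hM)]
      push_cast
      linarith

/-- The sup-norm neighbourhood of the frontier of `V n` of radius `d`. -/
def nearFrontier (n : ℕ) (d : ℝ) : Set (Fin n → ℝ) :=
  {x | ∃ b ∈ frontier (V n), dist x b ≤ d}

/-- The radius is `d` for reaching the frontier plus `(m + 1) * (2 / M) * 4 ^ m ≤ (m + 1) * d` for
moving the roots to the grid. -/
theorem nearFrontier_subset {m M : ℕ} (hM : 0 < M) {d : ℝ} (hd : 2 * 4 ^ m ≤ M * d) :
    nearFrontier (m + 1) d ⊆ ⋃ t : Fin 3 × (Fin m → Fin M),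
      Metric.closedBall (coeffMap (m + 1)
        (Fin.cons (extraRoot t.1 fun k => -2 + (4 * (t.2 k : ℝ) + 2) / M)
          fun k => -2 + (4 * (t.2 k : ℝ) + 2) / M)) ((m + 2) * d) := by
  rintro x ⟨b, hb, hxb⟩
  obtain ⟨j, w, hw, rfl⟩ := exists_extraRoot_of_mem_frontier hb
  have hM' : (0 : ℝ) < M := by exact_mod_cast hM
  choose κ hκ hκ' using fun k => exists_grid_point hM (hw k)
  refine Set.mem_iUnion.2 ⟨(j, κ), ?_⟩
  rw [Metric.mem_closedBall]
  refine (dist_triangle _ (coeffMap (m + 1) (Fin.cons (extraRoot j w) w)) _).trans ?_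
  have hd0 : 0 ≤ d := dist_nonneg.trans hxb
  have : dist (coeffMap (m + 1) (Fin.cons (extraRoot j w) w)) (coeffMap (m + 1)
        (Fin.cons (extraRoot j fun k => -2 + (4 * (κ k : ℝ) + 2) / M)
          fun k => -2 + (4 * (κ k : ℝ) + 2) / M)) ≤ (m + 1) * d := by
    rw [dist_pi_le_iff (by positivity)]
    intro i
    rw [Real.dist_eq]
    refine (abs_coeffMap_sub_le (δ := 2 / M) ?_ ?_ ?_ i).trans ?_
    · exact Fin.cases (abs_extraRoot_le j hw) hw
    · exact Fin.cases (abs_extraRoot_le j hκ) hκ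
    · exact Fin.cases (abs_extraRoot_sub_le j (by positivity) hκ') hκ'
    · rw [mul_assoc]
      gcongr
      rw [div_mul_eq_mul_div, div_le_iff₀ hM']
      linarith
  exact (add_le_add hxb this).trans (by linarith)

theorem volume_nearFrontier_le (m : ℕ) {d : ℝ} (hd0 : 0 < d) (hd1 : d ≤ 1) :
    volume (nearFrontier (m + 1) d) ≤
      ENNReal.ofReal (3 * (2 * 4 ^ m + 1) ^ m * (2 * (m + 2)) ^ (m + 1) * d) := by
  -- The least admissible `M`: then `M * d` is bounded, and `M ^ m` balls of volume proportional to
  -- `d ^ (m + 1)` leave a single factor `d`.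
  set M : ℕ := ⌈(2 * 4 ^ m : ℝ) / d⌉₊ with hMdef
  have hMpos : 0 < M := Nat.ceil_pos.2 (by positivity)
  have hM1 : (2 * 4 ^ m : ℝ) ≤ M * d := by
    rw [← div_le_iff₀ hd0]; exact Nat.le_ceil _
  have hM2 : (M : ℝ) * d ≤ 2 * 4 ^ m + 1 := by
    have := (Nat.ceil_lt_add_one (show (0 : ℝ) ≤ 2 * 4 ^ m / d by positivity)).le
    rw [← hMdef] at this
    calc (M : ℝ) * d ≤ (2 * 4 ^ m / d + 1) * d := by gcongr
      _ = 2 * 4 ^ m + d := by field_simp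
      _ ≤ _ := by linarith
  refine (measure_mono (nearFrontier_subset hMpos hM1)).trans ?_
  refine (measure_iUnion_fintype_le _ _).trans ?_
  simp only [Real.volume_pi_closedBall _ (show (0 : ℝ) ≤ (m + 2) * d by positivity),
    Finset.sum_const, Finset.card_univ, Fintype.card_prod, Fintype.card_fin, Fintype.card_fun,
    nsmul_eq_mul]
  rw [← ENNReal.ofReal_natCast, ← ENNReal.ofReal_mul (by positivity)]
  refine ENNReal.ofReal_le_ofReal ?_
  push_cast
  calc (3 * (M : ℝ) ^ m) * (2 * ((m + 2) * d)) ^ (m + 1)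
      = 3 * (M * d) ^ m * (2 * (m + 2)) ^ (m + 1) * d := by
        rw [mul_pow (M : ℝ) d, ← mul_assoc 2, mul_pow _ d, pow_succ d]; ring
    _ ≤ _ := by gcongr

/-! ### Lattice points -/

theorem exists_frontier_segment {E : Type*} [NormedAddCommGroup E] [NormedSpace ℝ E] {s : Set E}
    {x y : E} (hx : x ∈ s) (hy : y ∉ s) : ∃ z ∈ segment ℝ x y, z ∈ frontier s := by
  by_contra! h
  have hc : IsPreconnected (segment ℝ x y) := (convex_segment x y).isPreconnected
  have hsub : segment ℝ x y ⊆ interior s := by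
    refine hc.subset_of_closure_inter_subset isOpen_interior ?_ ?_
    · refine ⟨x, left_mem_segment ℝ x y, ?_⟩
      by_contra hxi
      exact h x (left_mem_segment ℝ x y) ⟨subset_closure hx, hxi⟩
    · rintro z ⟨hz, hz'⟩
      by_contra hzi
      exact h z hz' ⟨closure_mono interior_subset hz, hzi⟩
  exact hy (interior_subset (hsub (right_mem_segment ℝ x y)))

theorem mem_nearFrontier {n : ℕ} {d : ℝ} {x y : Fin n → ℝ} (hxy : dist x y ≤ d)
    (h : ¬ (x ∈ V n ↔ y ∈ V n)) : x ∈ nearFrontier n d := by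
  have hz : ∃ z ∈ segment ℝ x y, z ∈ frontier (V n) := by
    by_cases hx : x ∈ V n
    · exact exists_frontier_segment hx (by tauto)
    · rw [segment_symm]
      exact exists_frontier_segment (by tauto) hx
  obtain ⟨z, hz, hzf⟩ := hz
  refine ⟨z, hzf, le_trans ?_ hxy⟩
  have := dist_add_dist_of_mem_segment hz
  linarith [dist_nonneg (x := z) (y := y)]

theorem le_mesh {n : ℕ} (p q : Fin n → ℝ) (i : Fin n) : q i - p i ≤ mesh p q :=
  le_ciSup (f := fun i => q i - p i) (Set.finite_range _).bddAbove i

theorem abs_card_mul_covolume_sub_le {n : ℕ} (Λ : Submodule ℤ (Fin n → ℝ)) [DiscreteTopology Λ]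
    [IsZLattice ℝ Λ] {p q : Fin n → ℝ} (hΛ : IsRectilinearDomain Λ p q) (hd : 0 ≤ mesh p q)
    (hV : IsCompact (V n)) (hfin : ((Λ : Set (Fin n → ℝ)) ∩ V n).Finite)
    {B : ℝ} (hB0 : 0 ≤ B) (hB : volume (nearFrontier n (mesh p q)) ≤ ENNReal.ofReal B) :
    |(((Λ : Set (Fin n → ℝ)) ∩ V n).ncard : ℝ) * ZLattice.covolume Λ - volume.real (V n)| ≤ B := by
  classical
  have : MeasurableVAdd Λ (Fin n → ℝ) :=
    (inferInstance : MeasurableVAdd Λ.toAddSubgroup (Fin n → ℝ))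
  have : VAddInvariantMeasure Λ (Fin n → ℝ) volume :=
    (inferInstance : VAddInvariantMeasure Λ.toAddSubgroup (Fin n → ℝ) volume)
  have : Countable Λ := countable_of_Lindelof_of_discrete
  -- With a corner at the origin, all of `l +ᵥ R` lies within the mesh of `l`.
  set R : Set (Fin n → ℝ) := (-p) +ᵥ box p q with hR
  have hRdom : IsAddFundamentalDomain Λ R volume := by
    have : VAddCommClass (Fin n → ℝ) Λ (Fin n → ℝ) := ⟨fun a b c => by
      simp only [Submodule.vadd_def, vadd_eq_add]; abel⟩
    exact hΛ.isAddFundamentalDomain.vadd_of_comm (-p)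
  have hRcov : ZLattice.covolume Λ = volume.real R :=
    ZLattice.covolume_eq_measure_fundamentalDomain Λ volume hRdom
  have hRtop : volume R ≠ ⊤ := by
    intro h
    have := ZLattice.covolume_ne_zero Λ volume
    rw [hRcov, measureReal_def, h] at this
    simp at this
  have hdist : ∀ (l : Λ) (x : Fin n → ℝ), x ∈ l +ᵥ R → dist x (l : Fin n → ℝ) ≤ mesh p q := by
    rintro l x ⟨r, ⟨u, hu, rfl⟩, rfl⟩
    rw [dist_pi_le_iff hd]
    intro i
    have h1 := (hu i trivial).1
    have h2 := (hu i trivial).2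
    have h3 := le_mesh p q i
    have e : ((l +ᵥ (-p +ᵥ u) : Fin n → ℝ)) i = l.1 i + (-p i + u i) := rfl
    change dist ((l +ᵥ (-p +ᵥ u) : Fin n → ℝ) i) _ ≤ _
    rw [e, Real.dist_eq, abs_le]
    constructor <;> linarith
  have hfin' : {l : Λ | (l : Fin n → ℝ) ∈ V n}.Finite := by
    refine Set.Finite.of_finite_image (f := Subtype.val) (hfin.subset ?_)
      Subtype.val_injective.injOn
    rintro _ ⟨l, hl, rfl⟩
    exact ⟨l.2, hl⟩
  set T : Finset Λ := hfin'.toFinset with hT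
  have hTmem : ∀ l : Λ, l ∈ T ↔ (l : Fin n → ℝ) ∈ V n := fun l => by simp [hT]
  have hcard : ((Λ : Set (Fin n → ℝ)) ∩ V n).ncard = T.card := by
    have : ((Λ : Set (Fin n → ℝ)) ∩ V n) = Subtype.val '' (T : Set Λ) := by
      ext x
      simp [hT, and_comm]
    rw [this, Set.ncard_image_of_injective _ Subtype.val_injective, Set.ncard_coe_finset]
  set A : Set (Fin n → ℝ) := ⋃ l ∈ T, l +ᵥ R with hA
  have hAvol : volume A = T.card * volume R := by
    rw [hA, measure_biUnion_finset₀]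
    · simp
    · intro a _ b _ hab
      exact hRdom.aedisjoint hab
    · intro a _
      exact hRdom.nullMeasurableSet_vadd a
  have hAtop : volume A ≠ ⊤ := by
    rw [hAvol]; exact ENNReal.mul_ne_top (by simp) hRtop
  have hVtop : volume (V n) ≠ ⊤ := hV.measure_lt_top.ne
  have h1 : volume A ≤ volume (V n) + ENNReal.ofReal B := by
    refine (measure_mono (?_ : A ⊆ V n ∪ nearFrontier n (mesh p q))).trans
      ((measure_union_le _ _).trans (by gcongr))
    intro x hx
    simp only [hA, Set.mem_iUnion] at hx
    obtain ⟨l, hl, hxl⟩ := hx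
    by_cases hxV : x ∈ V n
    · exact Or.inl hxV
    · exact Or.inr (mem_nearFrontier (hdist l x hxl) fun h => hxV (h.2 ((hTmem l).1 hl)))
  have h2 : volume (V n) ≤ volume A + ENNReal.ofReal B := by
    refine (measure_mono_ae (?_ : V n ≤ᵐ[volume] (A ∪ nearFrontier n (mesh p q) : Set _))).trans
      ((measure_union_le _ _).trans (by gcongr))
    filter_upwards [hRdom.ae_covers] with x hx hxV
    obtain ⟨l, hl⟩ := hx
    have hxl : x ∈ (-l) +ᵥ R := ⟨l +ᵥ x, hl, neg_vadd_vadd l x⟩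
    by_cases hlV : ((-l : Λ) : Fin n → ℝ) ∈ V n
    · exact Or.inl (Set.mem_biUnion (Finset.mem_coe.2 ((hTmem _).2 hlV)) hxl)
    · exact Or.inr (mem_nearFrontier (hdist _ x hxl) fun h => hlV (h.1 hxV))
  have e : (((Λ : Set (Fin n → ℝ)) ∩ V n).ncard : ℝ) * ZLattice.covolume Λ = volume.real A := by
    rw [hcard, hRcov, measureReal_def, measureReal_def, hAvol]; simp
  rw [e]
  have h1' := ENNReal.toReal_mono (by finiteness) h1
  have h2' := ENNReal.toReal_mono (by finiteness) h2
  rw [ENNReal.toReal_add (by assumption) (by simp), ENNReal.toReal_ofReal hB0] at h1' h2'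
  rw [measureReal_def, measureReal_def, abs_le]
  constructor <;> linarith

/-! ### Comparison of the constants -/

theorem five_le_c₃ : 5 ≤ c₃ := by
  have h3 : (1.73 : ℝ) ≤ √3 := Real.le_sqrt_of_sq_le (by norm_num)
  have h2 : (0 : ℝ) < 1 + √2 := by positivity
  have he : (4.4 : ℝ) ≤ Real.exp (3 / 2) := by
    rw [show (3 / 2 : ℝ) = 1 + 1 / 2 by norm_num, Real.exp_add]
    have h1 := Real.exp_one_gt_d9
    have h2 : (1.625 : ℝ) ≤ Real.exp (1 / 2) := by
      have := Real.quadratic_le_exp_of_nonneg (x := 1 / 2) (by norm_num)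
      norm_num at this ⊢
      linarith
    calc (4.4 : ℝ) ≤ 2.7182818283 * 1.625 := by norm_num
      _ ≤ _ := by gcongr
  have e : c₃ = Real.exp (3 / 2) * 2 * √3 * (1 + √3 / 162) ^ 3 / 3 := by
    unfold c₃ c₂
    field_simp
  have h4 : (1 : ℝ) ≤ (1 + √3 / 162) ^ 3 := one_le_pow₀ (by linarith)
  rw [e]
  calc (5 : ℝ) ≤ 4.4 * 2 * 1.73 * 1 / 3 := by norm_num
    _ ≤ _ := by gcongr

theorem le_four_mul_c₁ : 1.15 ≤ 4 * c₁ := by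
  have h3 : (1.73 : ℝ) ≤ √3 := Real.le_sqrt_of_sq_le (by norm_num)
  unfold c₁
  linarith

/-- Feeds the induction step of `factorial_mul_pow_le`: 2.72 bounds `e`, 3.88 is just below `1.15 *
3.375`, and `2.25 = 1.5 ^ 2`. It fails at `m = 3`. -/
theorem quadratic_le_pow (m : ℕ) (hm : 4 ≤ m) :
    (2.72 : ℝ) * (m + 1) * (m + 2) ≤ 3.88 * 2.25 ^ m := by
  induction m, hm using Nat.le_induction with
  | base => norm_num
  | succ m hm ih =>
    have : (4 : ℝ) ≤ m := by exact_mod_cast hm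
    push_cast
    rw [pow_succ]
    nlinarith

theorem one_add_pow_le_exp (x : ℝ) (hx : 0 ≤ x) (m : ℕ) : (1 + x) ^ m ≤ Real.exp (m * x) := by
  rw [Real.exp_nat_mul]
  gcongr
  linarith [Real.add_one_le_exp x]

theorem add_three_pow_le (m : ℕ) : ((m : ℝ) + 3) ^ m ≤ 2.72 * (m + 2) ^ m := by
  have h : (m : ℝ) + 3 = (m + 2) * (1 + 1 / (m + 2)) := by field_simp; ring
  rw [h, mul_pow, mul_comm]
  gcongr
  refine (one_add_pow_le_exp _ (by positivity) m).trans ?_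
  refine (Real.exp_le_exp.2 (?_ : _ ≤ (1 : ℝ))).trans (by linarith [Real.exp_one_lt_d9])
  rw [mul_one_div, div_le_one (by positivity)]
  linarith

theorem factorial_mul_pow_le (m : ℕ) :
    48 / 7 * (m.factorial : ℝ) * (m + 2) ^ m ≤
      5 * (m + 1) * 1.15 ^ (m + 1) * 1.5 ^ ((m + 1) ^ 2) := by
  rcases Nat.lt_or_ge m 4 with h | h
  · interval_cases m <;> norm_num [Nat.factorial]
  induction m, h using Nat.le_induction with
  | base => norm_num [Nat.factorial]
  | succ m hm ih =>
    have hq := quadratic_le_pow m hm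
    have h3 := add_three_pow_le m
    have e : (1.5 : ℝ) ^ ((m + 1 + 1) ^ 2) = 1.5 ^ ((m + 1) ^ 2) * (3.375 * 2.25 ^ m) := by
      rw [show (m + 1 + 1) ^ 2 = (m + 1) ^ 2 + (3 + 2 * m) by ring, pow_add, pow_add 1.5 3,
        pow_mul]
      norm_num
    have hstep : ((m : ℝ) + 1) * ((m + 3) * 2.72) * (m + 1) ≤
        (m + 2) * (1.15 * (3.375 * 2.25 ^ m)) := by
      have : (0 : ℝ) ≤ 2.25 ^ m := by positivity
      have : (0 : ℝ) ≤ m := by positivity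
      nlinarith
    rw [Nat.factorial_succ, e]
    push_cast
    rw [show (m : ℝ) + 1 + 2 = m + 3 by ring, show (m : ℝ) + 1 + 1 = m + 2 by ring]
    have hm1 : (0 : ℝ) < m + 1 := by positivity
    -- The factor `m + 1` on the right of the induction hypothesis becomes `m + 2`; multiplying
    -- through avoids their quotient.
    refine le_of_mul_le_mul_right ?_ hm1
    calc 48 / 7 * (((m : ℝ) + 1) * m.factorial) * (m + 3) ^ (m + 1) * (m + 1)
        = 48 / 7 * m.factorial * ((m + 1) * (m + 3) * (m + 1)) * (m + 3) ^ m := by ring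
      _ ≤ 48 / 7 * m.factorial * ((m + 1) * (m + 3) * (m + 1)) * (2.72 * (m + 2) ^ m) := by
        gcongr
      _ = (48 / 7 * m.factorial * (m + 2) ^ m) * ((m + 1) * ((m + 3) * 2.72) * (m + 1)) := by ring
      _ ≤ (5 * (m + 1) * 1.15 ^ (m + 1) * 1.5 ^ ((m + 1) ^ 2)) *
          ((m + 2) * (1.15 * (3.375 * 2.25 ^ m))) := by gcongr
      _ = _ := by ring

/-- The ratio is at most `exp (m / (2 * 4 ^ m)) ≤ exp (1 / 8)`, and `exp (-1 / 8) ≥ 7 / 8`. -/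
theorem two_mul_four_pow_add_one_pow_le (m : ℕ) :
    (2 * 4 ^ m + 1 : ℝ) ^ m ≤ 8 / 7 * (2 * 4 ^ m) ^ m := by
  have h : (2 * 4 ^ m + 1 : ℝ) = (2 * 4 ^ m) * (1 + 1 / (2 * 4 ^ m)) := by field_simp
  rw [h, mul_pow, mul_comm]
  gcongr
  refine (one_add_pow_le_exp _ (by positivity) m).trans ?_
  have h4 : (4 * m : ℝ) ≤ 4 ^ m := by
    have : ∀ k : ℕ, 4 * k ≤ 4 ^ k := by
      intro k
      cases k with
      | zero => simp
      | succ k => rw [pow_succ']; exact Nat.mul_le_mul_left 4 (Nat.lt_pow_self (by norm_num))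
    exact_mod_cast this m
  have h8 : (m : ℝ) * (1 / (2 * 4 ^ m)) ≤ 1 / 8 := by
    rw [mul_one_div, div_le_iff₀ (by positivity)]
    linarith
  refine (Real.exp_le_exp.2 h8).trans ?_
  have h7 := Real.add_one_le_exp (-(1 / 8) : ℝ)
  have hp := Real.exp_pos (1 / 8)
  have hinv : Real.exp (1 / 8) * Real.exp (-(1 / 8)) = 1 := by rw [← Real.exp_add]; simp
  nlinarith

/-- Split `6 = 4 * 1.5`: the powers of 4 absorb the grid count and turn `c₁` into `4 * c₁ > 1`,
while `1.5 ^ ((m + 1) ^ 2)` outgrows `m! * (m + 2) ^ m`. -/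
theorem covering_constant_le (m : ℕ) :
    3 * (2 * 4 ^ m + 1 : ℝ) ^ m * (2 * (m + 2)) ^ (m + 1) ≤
      6 ^ ((m + 1) ^ 2) * c₁ ^ (m + 1) * c₃ * (((m : ℝ) + 1) * (m + 1 + 1) / m.factorial) := by
  have hf : (0 : ℝ) < m.factorial := by exact_mod_cast m.factorial_pos
  rw [← mul_div_assoc, le_div_iff₀ hf]
  have h6 : (6 : ℝ) ^ ((m + 1) ^ 2) * c₁ ^ (m + 1) =
      4 ^ (m ^ 2) * 4 ^ m * ((4 * c₁) ^ (m + 1) * 1.5 ^ ((m + 1) ^ 2)) := by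
    rw [show (6 : ℝ) = 4 * 1.5 by norm_num, mul_pow, mul_pow 4 c₁,
      show (4 : ℝ) ^ ((m + 1) ^ 2) = 4 ^ (m ^ 2) * 4 ^ m * 4 ^ (m + 1) by
        rw [← pow_add, ← pow_add]; congr 1; ring]
    ring
  have h2 : (2 * 4 ^ m : ℝ) ^ m * 2 ^ (m + 1) = 2 * (4 ^ (m ^ 2) * 4 ^ m) := by
    rw [mul_pow, ← pow_mul, ← sq, pow_succ 2 m, show (4 : ℝ) ^ m = 2 ^ m * 2 ^ m by
      rw [← mul_pow]; norm_num]
    ring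
  calc 3 * (2 * 4 ^ m + 1 : ℝ) ^ m * (2 * (m + 2)) ^ (m + 1) * m.factorial
      ≤ 3 * (8 / 7 * (2 * 4 ^ m) ^ m) * (2 * (m + 2)) ^ (m + 1) * m.factorial := by
        gcongr
        exact two_mul_four_pow_add_one_pow_le m
    _ = 24 / 7 * ((2 * 4 ^ m) ^ m * 2 ^ (m + 1)) * (m + 2) ^ (m + 1) * m.factorial := by
        rw [mul_pow 2 ((m : ℝ) + 2)]; ring
    _ = 4 ^ (m ^ 2) * 4 ^ m * (m + 2) * (48 / 7 * m.factorial * (m + 2) ^ m) := by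
        rw [h2]; ring
    _ ≤ 4 ^ (m ^ 2) * 4 ^ m * (m + 2) *
        (5 * (m + 1) * 1.15 ^ (m + 1) * 1.5 ^ ((m + 1) ^ 2)) := by
        exact mul_le_mul_of_nonneg_left (factorial_mul_pow_le m) (by positivity)
    _ ≤ 4 ^ (m ^ 2) * 4 ^ m * (m + 2) *
        (c₃ * (m + 1) * (4 * c₁) ^ (m + 1) * 1.5 ^ ((m + 1) ^ 2)) := by
        have h5 := five_le_c₃
        have h0 : 0 ≤ c₃ := by linarith
        gcongr
        exact le_four_mul_c₁
    _ = _ := by rw [h6]; ring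

end UnitCirclePoly

theorem proposition2p3p1 (n : ℕ) (hn : 0 < n)
    (Λ : Submodule ℤ (Fin n → ℝ)) [DiscreteTopology Λ] [IsZLattice ℝ Λ]
    (p q : Fin n → ℝ) (hΛ : UnitCirclePoly.IsRectilinearDomain Λ p q)
    (hd : UnitCirclePoly.mesh p q ≤ 1) :
    ((Λ : Set (Fin n → ℝ)) ∩ UnitCirclePoly.V n).Finite ∧
    MeasureTheory.volume (UnitCirclePoly.V n) ≠ ⊤ ∧
    |(((Λ : Set (Fin n → ℝ)) ∩ UnitCirclePoly.V n).ncard : ℝ) -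
        (MeasureTheory.volume (UnitCirclePoly.V n)).toReal / ZLattice.covolume Λ| ≤
      6 ^ (n ^ 2) * UnitCirclePoly.c₁ ^ n * UnitCirclePoly.c₃ *
        ((n : ℝ) * (n + 1) / (Nat.factorial (n - 1) : ℝ)) *
        (UnitCirclePoly.mesh p q / ZLattice.covolume Λ) := by
  obtain ⟨m, rfl⟩ : ∃ m, n = m + 1 := ⟨n - 1, by omega⟩
  have hV := UnitCirclePoly.isCompact_V m
  have hmesh : 0 < UnitCirclePoly.mesh p q :=
    (sub_pos.2 (hΛ.lt 0)).trans_le (UnitCirclePoly.le_mesh p q 0)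
  have hfin : ((Λ : Set (Fin (m + 1) → ℝ)) ∩ UnitCirclePoly.V (m + 1)).Finite := by
    rw [Set.inter_comm]
    have hcl : IsClosed (Λ : Set (Fin (m + 1) → ℝ)) :=
      AddSubgroup.isClosed_of_discrete (H := Λ.toAddSubgroup)
    exact Metric.finite_isBounded_inter_isClosed ⟨inferInstanceAs (DiscreteTopology Λ)⟩
      hV.isBounded hcl
  have hcov : 0 < ZLattice.covolume Λ := ZLattice.covolume_pos Λ
  refine ⟨hfin, hV.measure_lt_top.ne, ?_⟩
  have key := UnitCirclePoly.abs_card_mul_covolume_sub_le Λ hΛ hmesh.le hV hfin (by positivity)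
    (UnitCirclePoly.volume_nearFrontier_le m hmesh hd)
  -- Multiplying by the covolume reduces the claim to the comparison of volumes in `key`.
  rw [← mul_div_assoc, le_div_iff₀ hcov, ← abs_of_pos hcov, ← abs_mul, abs_of_pos hcov, sub_mul,
    div_mul_cancel₀ _ hcov.ne']
  refine key.trans ?_
  have h := UnitCirclePoly.covering_constant_le m
  push_cast
  exact mul_le_mul_of_nonneg_right h hmesh.le
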